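/- Let $n\ge 2$, let $\Omega\subset\mathbb{R}^n$ be a non-empty, bounded, open set, and let $\alpha:\Omega\to[0,n)$ be log-Hölder continuous, i.e. there is $c>0$ with $|\alpha(x)-\alpha(y)|\le c/\log(e+1/|x-y|)$ for all $x,y\in\Omega$, $x\ne y$. Suppose that $$0<\alpha^-:=\operatorname*{ess\,inf}_{x\in\Omega}\alpha(x)\le\alpha^+:=\operatorname*{ess\,sup}_{x\in\Omega}\alpha(x)<n .$$ For a measurable $f:\Omega\to\mathbb{R}$ and $x\in\Omega$ let $$I_{\alpha(\cdot)}f(x):=\int_\Omega\frac{|f(y)|}{|x-y|^{n-\alpha(x)}}\,dy\in[0,\infty]$$ be the variable order Riesz potential. With $p(x):=n/\alpha(x)$, let $L^{n/\alpha(\cdot)}(\Omega)$ be the set of measurable $f:\Omega\to\mathbb{R}$ with $\int_\Omega|f(x)|^{p(x)}\,dx<\infty$, with the Luxemburg norm $\|f\|_{L^{n/\alpha(\cdot)}(\Omega)}:=\inf\{\lambda>0:\int_\Omega|f(x)/\lambda|^{p(x)}\,dx\le1\}$. For $E\subset\Omega$ let $$\mathcal{H}_\infty^{n-\alpha(\cdot)}(E):=\inf\Big\{\sum_{i=1}^\infty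 r_i^{\,n-\alpha(x_i)}: x_i\in\Omega,\ r_i>0,\ E\subset\bigcup_{i=1}^\infty B(x_i,r_i)\Big\}$$ be the variable dimensional Hausdorff content, where $B(x,r)$ is the open ball. Then there exist constants $c_1,c_2>0$, independent of $f$ and $t$, such that $$\mathcal{H}_\infty^{n-\alpha(\cdot)}\big(\{x\in\Omega: I_{\alpha(\cdot)}f(x)>t\}\big)\le c_1\exp\Big(-c_2\,t^{\frac{n}{n-\alpha^-}}\Big)$$ for all $t\ge0$ and all $f\in L^{n/\alpha(\cdot)}(\Omega)$ with $\|f\|_{L^{n/\alpha(\cdot)}(\Omega)}\le\frac{1}{2(1+|\Omega|)}$, where $|\Omega|$ is the Lebesgue measure of $\Omega$. -/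

import Mathlib

open MeasureTheory

noncomputable section

namespace VarRiesz

/-- `n`-dimensional Euclidean space. -/
abbrev Space (n : ℕ) : Type := EuclideanSpace ℝ (Fin n)

/-- Log-Hölder continuity of `g` on `U`. -/
def LogHolderOn {n : ℕ} (U : Set (Space n)) (g : Space n → ℝ) : Prop :=
  ∃ c : ℝ, 0 < c ∧ ∀ x ∈ U, ∀ y ∈ U, x ≠ y →
    |g x - g y| ≤ c / Real.log (Real.exp 1 + 1 / dist x y)

/-- `g⁻`, the essential infimum of `g` over `U`. -/
def essInfOn {n : ℕ} (U : Set (Space n)) (g : Space n → ℝ) : ℝ :=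
  essInf g (volume.restrict U)

/-- `g⁺`, the essential supremum of `g` over `U`. -/
def essSupOn {n : ℕ} (U : Set (Space n)) (g : Space n → ℝ) : ℝ :=
  essSup g (volume.restrict U)

/-- The modular `∫_U |f(x)|^{p(x)} dx`, with values in `[0, ∞]`. -/
def modular {n : ℕ} (U : Set (Space n)) (p f : Space n → ℝ) : ENNReal :=
  ∫⁻ x in U, ENNReal.ofReal (|f x| ^ p x)

/-- Membership in `L^{p(·)}(U)`: `f` is Lebesgue measurable on `U` with finite modular. -/
def MemVarLp {n : ℕ} (U : Set (Space n)) (p f : Space n → ℝ) : Prop :=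
  AEStronglyMeasurable f (volume.restrict U) ∧ modular U p f < ⊤

/-- The Luxemburg norm of `L^{p(·)}(U)`. -/
def luxemburgNorm {n : ℕ} (U : Set (Space n)) (p f : Space n → ℝ) : ℝ :=
  sInf {l : ℝ | 0 < l ∧ modular U p (fun x => f x / l) ≤ 1}

/-- The variable order Riesz potential `∫_Ω |f(y)| / |x - y|^{n - α(x)} dy`, with values in
`[0, ∞]`. -/
def rieszPotential {n : ℕ} (Ω : Set (Space n)) (α f : Space n → ℝ) (x : Space n) : ENNReal :=
  ∫⁻ y in Ω, ENNReal.ofReal (|f y| / dist x y ^ ((n : ℝ) - α x))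

/-- The variable dimensional Hausdorff content of `A` for a dimension function `β` that is defined
on `U`: the infimum of `∑ rᵢ ^ β(xᵢ)` over all sequences of open balls `B(xᵢ, rᵢ)` that cover `A`
and have their centres in the domain `U` of `β`. Values of `β` off `U` play no role. -/
def hausdorffContent {n : ℕ} (U : Set (Space n)) (β : Space n → ℝ) (A : Set (Space n)) : ENNReal :=
  ⨅ (x : ℕ → Space n) (r : ℕ → ℝ) (_ : ∀ i, x i ∈ U) (_ : ∀ i, 0 < r i)
    (_ : A ⊆ ⋃ i, Metric.ball (x i) (r i)), ∑' i, ENNReal.ofReal (r i ^ β (x i))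

/-- Admitting more centres, and any extension of the dimension function to them, can only decrease
the content. -/
theorem hausdorffContent_anti {n : ℕ} {U V : Set (Space n)} (hUV : U ⊆ V) {β γ : Space n → ℝ}
    (h : ∀ x ∈ U, γ x = β x) (A : Set (Space n)) :
    hausdorffContent V γ A ≤ hausdorffContent U β A := by
  unfold hausdorffContent
  refine le_iInf fun x => le_iInf fun r => le_iInf fun hx => le_iInf fun hr => le_iInf fun hA => ?_
  refine iInf_le_of_le x (iInf_le_of_le r (iInf_le_of_le (fun i => hUV (hx i))
    (iInf_le_of_le hr (iInf_le_of_le hA ?_))))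
  simp [h _ (hx _)]

end VarRiesz

end

/-!
Since `α` is log-Hölder continuous, on an annulus of radius `r` around `x` the power
`(|f|^{n/α(y)})^{α(y)/n} = |f|` may be traded for `(|f|^{n/α(y)})^{α(x)/n}` at the cost of a bounded
factor and of errors of lower order. With `μ = |f|^{n/α(·)} dy` and the dyadic annuli `A_k` around
`x`, Hölder's inequality then gives `I f(x) ≤ C (1 + ∑ μ(A_k)^{α(x)/n})`.

As `∑ μ(A_k) ≤ 1`, the first `K` terms contribute at most `K^{1 - α(x)/n} ≤ K^{1 - α⁻/n}`. If the
sum is larger than that by more than a constant, the remaining terms do not decay geometrically,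
which yields a ball around `x` with `r^{n - α(x)} ≤ C ρ^K μ(B(x, r))`, where
`ρ = 2^{-(n - α⁺)} < 1`. By Vitali's covering lemma the set of such points has content at most
`C ρ^K`, and the level `t ∼ K^{1 - α⁻/n}` corresponds to `K ∼ t^{n/(n - α⁻)}`.
-/

namespace VarRiesz

section EssentialBounds

theorem LogHolderOn.exists_abs_sub_mul_neg_log_le {n : ℕ} {U : Set (Space n)} {g : Space n → ℝ}
    (h : LogHolderOn U g) :
    ∃ c : ℝ, 0 < c ∧ ∀ x ∈ U, ∀ y ∈ U, ∀ r : ℝ, 0 < r → dist x y ≤ r →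
      |g x - g y| * -Real.log r ≤ c := by
  obtain ⟨c, hc, h⟩ := h
  refine ⟨c, hc, fun x hx y hy r hr hxyr => ?_⟩
  rcases eq_or_ne x y with rfl | hxy
  · simpa using hc.le
  rcases le_or_gt 0 (Real.log r) with hlog | hlog
  · exact (mul_nonpos_of_nonneg_of_nonpos (abs_nonneg _) (neg_nonpos.2 hlog)).trans hc.le
  have hd : 0 < dist x y := dist_pos.2 hxy
  have hle : -Real.log r ≤ Real.log (Real.exp 1 + 1 / dist x y) := by
    rw [← Real.log_inv, inv_eq_one_div]
    refine Real.log_le_log (by positivity) ?_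
    linarith [one_div_le_one_div_of_le hd hxyr, Real.exp_pos 1]
  calc |g x - g y| * -Real.log r
      ≤ c / Real.log (Real.exp 1 + 1 / dist x y) * Real.log (Real.exp 1 + 1 / dist x y) :=
        mul_le_mul (h x hx y hy hxy) hle (by linarith)
          ((abs_nonneg _).trans (h x hx y hy hxy))
    _ = c := div_mul_cancel₀ _ (by linarith)

theorem LogHolderOn.continuousOn {n : ℕ} {U : Set (Space n)} {g : Space n → ℝ}
    (h : LogHolderOn U g) : ContinuousOn g U := by
  obtain ⟨c, hc, h⟩ := h.exists_abs_sub_mul_neg_log_le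
  refine Metric.continuousOn_iff.2 fun x hx ε hε => ?_
  refine ⟨Real.exp (-(2 * c / ε)), Real.exp_pos _, fun y hy hyx => ?_⟩
  have hgyx := h y hy x hx _ (Real.exp_pos _) hyx.le
  rw [Real.log_exp, neg_neg, mul_div_assoc', div_le_iff₀ hε] at hgyx
  rw [Real.dist_eq]
  nlinarith

theorem forall_mem_of_ae_mem_of_continuousOn {X Y : Type*} [TopologicalSpace X]
    [MeasurableSpace X] [OpensMeasurableSpace X] {μ : Measure X} [μ.IsOpenPosMeasure]
    [TopologicalSpace Y] {U : Set X} (hU : IsOpen U) {g : X → Y} (hg : ContinuousOn g U)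
    {S : Set Y} (hS : IsClosed S) (h : ∀ᵐ x ∂μ.restrict U, g x ∈ S) : ∀ x ∈ U, g x ∈ S := by
  intro x hx
  by_contra hxS
  have hV : IsOpen (U ∩ g ⁻¹' Sᶜ) := hg.isOpen_inter_preimage hU hS.isOpen_compl
  rw [ae_restrict_iff' hU.measurableSet, ae_iff] at h
  have hsub : U ∩ g ⁻¹' Sᶜ ⊆ {y | ¬(y ∈ U → g y ∈ S)} := fun y hy hmem => hy.2 (hmem hy.1)
  exact (hV.measure_pos μ ⟨x, hx, hxS⟩).ne' (measure_mono_null hsub h)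

variable {n : ℕ} {U : Set (Space n)} {g : Space n → ℝ}

theorem essInfOn_le (hU : IsOpen U) (hg : ContinuousOn g U) {a : ℝ} (ha : ∀ x ∈ U, a ≤ g x) :
    ∀ x ∈ U, essInfOn U g ≤ g x :=
  forall_mem_of_ae_mem_of_continuousOn (S := Set.Ici _) hU hg isClosed_Ici
    (ae_essInf_le ⟨a, Filter.eventually_map.2 (ae_restrict_of_forall_mem hU.measurableSet ha)⟩)

theorem le_essSupOn (hU : IsOpen U) (hg : ContinuousOn g U) {b : ℝ} (hb : ∀ x ∈ U, g x ≤ b) :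
    ∀ x ∈ U, g x ≤ essSupOn U g :=
  forall_mem_of_ae_mem_of_continuousOn (S := Set.Iic _) hU hg isClosed_Iic
    (ae_le_essSup ⟨b, Filter.eventually_map.2 (ae_restrict_of_forall_mem hU.measurableSet hb)⟩)

theorem nonempty_of_essInfOn_pos (h : 0 < essInfOn U g) : U.Nonempty := by
  refine Set.nonempty_iff_ne_empty.2 ?_
  rintro rfl
  simp [essInfOn, essInf, Filter.liminf, Filter.limsInf] at h

end EssentialBounds

section Modular

variable {n : ℕ} {U : Set (Space n)} {p f : Space n → ℝ}

theorem exists_modular_div_le_one (hU : MeasurableSet U) (hp : ∀ x ∈ U, 1 ≤ p x)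
    (hf : modular U p f < ⊤) : ∃ l : ℝ, 0 < l ∧ modular U p (fun x => f x / l) ≤ 1 := by
  set m := (modular U p f).toReal with hm
  have hm0 : 0 < 1 + m := by positivity
  have hpointwise : ∀ x ∈ U, ENNReal.ofReal (|f x / (1 + m)| ^ p x) ≤
      ENNReal.ofReal (1 + m)⁻¹ * ENNReal.ofReal (|f x| ^ p x) := by
    intro x hx
    rw [← ENNReal.ofReal_mul (by positivity), abs_div, abs_of_pos hm0, div_eq_inv_mul,
      Real.mul_rpow (by positivity) (abs_nonneg _)]
    gcongr
    exact Real.rpow_le_self_of_le_one (by positivity)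
      (inv_le_one_of_one_le₀ (le_add_of_nonneg_right ENNReal.toReal_nonneg)) (hp x hx)
  refine ⟨1 + m, hm0, ?_⟩
  calc modular U p (fun x => f x / (1 + m))
      ≤ ∫⁻ x in U, ENNReal.ofReal (1 + m)⁻¹ * ENNReal.ofReal (|f x| ^ p x) :=
        setLIntegral_mono' hU hpointwise
    _ = ENNReal.ofReal (1 + m)⁻¹ * modular U p f :=
        lintegral_const_mul' _ _ ENNReal.ofReal_ne_top
    _ = ENNReal.ofReal ((1 + m)⁻¹ * m) := by
        rw [ENNReal.ofReal_mul (by positivity), hm, ENNReal.ofReal_toReal hf.ne]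
    _ ≤ 1 := by
        rw [ENNReal.ofReal_le_one, inv_mul_le_one₀ hm0]
        linarith

theorem modular_le_ofReal_rpow_mul_modular_div (hU : MeasurableSet U) {q : ℝ}
    (hp : ∀ x ∈ U, p x ∈ Set.Icc 0 q) {l c : ℝ} (hl : 0 < l) (hlc : l ≤ c) (hc : 1 ≤ c) :
    modular U p f ≤ ENNReal.ofReal (c ^ q) * modular U p (fun x => f x / l) := by
  rw [modular, modular, ← lintegral_const_mul' _ _ ENNReal.ofReal_ne_top]
  refine setLIntegral_mono' hU fun x hx => ?_
  rw [← ENNReal.ofReal_mul (by positivity)]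
  refine ENNReal.ofReal_le_ofReal ?_
  calc |f x| ^ p x = l ^ p x * |f x / l| ^ p x := by
        rw [← Real.mul_rpow hl.le (abs_nonneg _), abs_div, abs_of_pos hl,
          mul_div_cancel₀ _ hl.ne']
    _ ≤ c ^ p x * |f x / l| ^ p x := by gcongr; exact (hp x hx).1
    _ ≤ c ^ q * |f x / l| ^ p x := by gcongr; exact (hp x hx).2

theorem modular_le_one_of_luxemburgNorm_le_one (hU : MeasurableSet U) {q : ℝ}
    (hp : ∀ x ∈ U, p x ∈ Set.Icc 1 q) (hf : modular U p f < ⊤) (hnorm : luxemburgNorm U p f ≤ 1) :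
    modular U p f ≤ 1 := by
  have hle : ∀ c : ℝ, 1 < c → modular U p f ≤ ENNReal.ofReal (c ^ q) := by
    intro c hc
    obtain ⟨l, ⟨hl, hl1⟩, hlc⟩ := exists_lt_of_csInf_lt
      (exists_modular_div_le_one hU (fun x hx => (hp x hx).1) hf) (hnorm.trans_lt hc)
    exact (modular_le_ofReal_rpow_mul_modular_div hU
      (fun x hx => ⟨zero_le_one.trans (hp x hx).1, (hp x hx).2⟩) hl hlc.le hc.le).trans
      (mul_le_of_le_one_right' hl1)
  have hlim : Filter.Tendsto (fun c : ℝ => ENNReal.ofReal (c ^ q)) (nhdsWithin 1 (Set.Ioi 1))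
      (nhds 1) := by
    have hcont : ContinuousAt (fun c : ℝ => c ^ q) 1 :=
      Real.continuousAt_rpow_const 1 q (Or.inl one_ne_zero)
    simpa using (ENNReal.tendsto_ofReal hcont.tendsto).mono_left nhdsWithin_le_nhds
  exact ge_of_tendsto hlim (eventually_mem_nhdsWithin.mono hle)

end Modular

section HausdorffContent

variable {n : ℕ} {U A B : Set (Space n)} {β : Space n → ℝ}

theorem hausdorffContent_mono (hAB : A ⊆ B) : hausdorffContent U β A ≤ hausdorffContent U β B :=
  iInf₂_mono fun _ _ => iInf₂_mono fun _ _ => iInf_mono' fun hB => ⟨hAB.trans hB, le_rfl⟩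

theorem hausdorffContent_le_tsum (hU : U.Nonempty) (hβ : ∀ x ∈ U, 0 < β x) {ι : Type*}
    [Countable ι] {x : ι → Space n} {r : ι → ℝ} (hx : ∀ i, x i ∈ U) (hr : ∀ i, 0 < r i)
    (hA : A ⊆ ⋃ i, Metric.ball (x i) (r i)) :
    hausdorffContent U β A ≤ ∑' i, ENNReal.ofReal (r i ^ β (x i)) := by
  -- Covers are indexed by `ℕ`, so a finite one is padded by balls of arbitrarily small total cost.
  obtain ⟨x₀, hx₀⟩ := hU
  refine ENNReal.le_of_forall_pos_le_add fun ε hε _ => ?_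
  obtain ⟨δ, hδ, hδε⟩ := ENNReal.exists_pos_sum_of_countable (ENNReal.coe_ne_zero.2 hε.ne') ℕ
  obtain ⟨e⟩ : Nonempty (ℕ ≃ ι ⊕ ℕ) := by
    obtain ⟨_⟩ := nonempty_denumerable (ι ⊕ ℕ)
    exact ⟨(Denumerable.eqv (ι ⊕ ℕ)).symm⟩
  set y : ι ⊕ ℕ → Space n := Sum.elim x fun _ => x₀
  set s : ι ⊕ ℕ → ℝ := Sum.elim r fun k => (δ k : ℝ) ^ (β x₀)⁻¹ with hs
  have hyU : ∀ j, y j ∈ U := Sum.rec hx fun _ => hx₀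
  have hspos : ∀ j, 0 < s j := Sum.rec hr fun k => Real.rpow_pos_of_pos (NNReal.coe_pos.2 (hδ k)) _
  have hcover : A ⊆ ⋃ k, Metric.ball (y (e k)) (s (e k)) := by
    rw [e.surjective.iUnion_comp fun j => Metric.ball (y j) (s j)]
    exact hA.trans (Set.iUnion_subset fun i =>
      Set.subset_iUnion (fun j => Metric.ball (y j) (s j)) (Sum.inl i))
  have hpad : ∀ k, ENNReal.ofReal (s (Sum.inr k) ^ β x₀) = δ k := fun k => by
    rw [hs, Sum.elim_inr, Real.rpow_inv_rpow (δ k).coe_nonneg (hβ x₀ hx₀).ne',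
      ENNReal.ofReal_coe_nnreal]
  calc hausdorffContent U β A
      ≤ ∑' k, ENNReal.ofReal (s (e k) ^ β (y (e k))) :=
        iInf₂_le_of_le _ _ (iInf₂_le_of_le (fun k => hyU (e k)) (fun k => hspos (e k))
          (iInf_le _ hcover))
    _ = ∑' j, ENNReal.ofReal (s j ^ β (y j)) :=
        e.tsum_eq fun j => ENNReal.ofReal (s j ^ β (y j))
    _ = ∑' i, ENNReal.ofReal (r i ^ β (x i)) + ∑' k, (δ k : ENNReal) := by
        rw [Summable.tsum_sum ENNReal.summable ENNReal.summable]
        exact congrArg _ (tsum_congr hpad)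
    _ ≤ ∑' i, ENNReal.ofReal (r i ^ β (x i)) + ε := by gcongr

theorem hausdorffContent_le_of_subset_ball (hβ : ∀ x ∈ U, 0 < β x) {x : Space n} (hx : x ∈ U)
    {r : ℝ} (hr : 0 < r) (hA : A ⊆ Metric.ball x r) :
    hausdorffContent U β A ≤ ENNReal.ofReal (r ^ β x) := by
  simpa using hausdorffContent_le_tsum ⟨x, hx⟩ hβ (x := fun _ : Unit => x) (r := fun _ => r)
    (fun _ => hx) (fun _ => hr) (hA.trans (Set.subset_iUnion_of_subset () subset_rfl))

theorem hausdorffContent_le_of_forall_closedBall (hU : U.Nonempty)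
    (hβ : ∀ x ∈ U, β x ∈ Set.Ioc 0 (n : ℝ)) (hAU : A ⊆ U) (μ : Measure (Space n)) {ε : ENNReal}
    {R : ℝ} (h : ∀ x ∈ A, ∃ r : ℝ, 0 < r ∧ r ≤ R ∧
      ENNReal.ofReal (r ^ β x) ≤ ε * μ (Metric.closedBall x r)) :
    hausdorffContent U β A ≤ 6 ^ n * (ε * μ Set.univ) := by
  choose! r hr hrR hrμ using h
  obtain ⟨u, huA, hdisj, hcov⟩ :=
    Vitali.exists_disjoint_subfamily_covering_enlargement_closedBall A id r R hrR 5 (by norm_num)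
  simp only [id] at hdisj hcov
  have hcountable : u.Countable := hdisj.countable_of_nonempty_interior fun x hx =>
    ⟨x, Metric.ball_subset_interior_closedBall (Metric.mem_ball_self (hr x (huA hx)))⟩
  have := hcountable.to_subtype
  have hru : ∀ i : u, 0 < r i := fun i => hr i (huA i.2)
  have hcover : A ⊆ ⋃ i : u, Metric.ball (i : Space n) (6 * r i) := by
    intro x hx
    obtain ⟨z, hz, hxz⟩ := hcov x hx
    exact Set.mem_iUnion.2 ⟨⟨z, hz⟩, Metric.closedBall_subset_ball
      (by linarith [hr z (huA hz)]) (hxz (Metric.mem_closedBall_self (hr x hx).le))⟩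
  have hterm : ∀ i : u, ENNReal.ofReal ((6 * r i) ^ β i) ≤
      6 ^ n * (ε * μ (Metric.closedBall i (r i))) := by
    intro i
    rw [Real.mul_rpow (by norm_num) (hru i).le, ENNReal.ofReal_mul (by positivity)]
    refine mul_le_mul' ?_ (hrμ i (huA i.2))
    rw [← ENNReal.ofReal_ofNat 6, ← ENNReal.ofReal_pow (by norm_num), ← Real.rpow_natCast]
    exact ENNReal.ofReal_le_ofReal
      (Real.rpow_le_rpow_of_exponent_le (by norm_num) (hβ i (hAU (huA i.2))).2)
  calc hausdorffContent U β A ≤ ∑' i : u, ENNReal.ofReal ((6 * r i) ^ β i) :=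
        hausdorffContent_le_tsum hU (fun x hx => (hβ x hx).1) (fun i => hAU (huA i.2))
          (fun i => mul_pos (by norm_num) (hru i)) hcover
    _ ≤ ∑' i : u, 6 ^ n * (ε * μ (Metric.closedBall i (r i))) := ENNReal.tsum_le_tsum hterm
    _ = 6 ^ n * (ε * ∑' i : u, μ (Metric.closedBall i (r i))) := by
        rw [ENNReal.tsum_mul_left, ENNReal.tsum_mul_left]
    _ ≤ 6 ^ n * (ε * μ Set.univ) := by
        gcongr
        exact (tsum_meas_le_meas_iUnion_of_disjoint μ
          (fun i => Metric.isClosed_closedBall.measurableSet)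
          ((pairwise_subtype_iff_pairwise_set _ _).2 hdisj)).trans
          (measure_mono (Set.subset_univ _))

end HausdorffContent

section PowerInequalities

theorem rpow_le_one_add_exp_mul_rpow_add {G s θ θ₀ M L d : ℝ} (hG : 0 ≤ G) (hs : 0 < s)
    (hM : 0 ≤ M) (hθ : 0 ≤ θ) (hθ1 : θ ≤ 1) (hd : 0 ≤ d) (hdM : d ≤ M * (1 - θ))
    (hL : |θ - θ₀| * -Real.log s ≤ L) :
    G ^ θ ≤ 1 + Real.exp (M * L) * G ^ θ₀ + s ^ d * G := by
  have hterm₂ : 0 ≤ Real.exp (M * L) * G ^ θ₀ := by positivity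
  have hterm₃ : 0 ≤ s ^ d * G := by positivity
  rcases le_or_gt G 1 with hG1 | hG1
  · linarith [Real.rpow_le_one hG hG1 hθ]
  have hG0 : 0 < G := by linarith
  -- Changing the exponent costs a bounded factor while `G ≤ s ^ (-M)`; beyond that threshold the
  -- gap between `θ` and `1` pays for the factor `s ^ d`.
  rcases le_or_gt (Real.log G) (M * -Real.log s) with hcase | hcase
  · have hfactor : G ^ θ ≤ Real.exp (M * L) * G ^ θ₀ := by
      rw [Real.rpow_def_of_pos hG0, Real.rpow_def_of_pos hG0, ← Real.exp_add, Real.exp_le_exp]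
      have hlog : Real.log G * (θ - θ₀) ≤ M * L :=
        calc Real.log G * (θ - θ₀) ≤ Real.log G * |θ - θ₀| :=
              mul_le_mul_of_nonneg_left (le_abs_self _) (Real.log_nonneg hG1.le)
          _ ≤ M * -Real.log s * |θ - θ₀| := by gcongr
          _ = M * (|θ - θ₀| * -Real.log s) := by ring
          _ ≤ M * L := by gcongr
      linarith
    linarith
  · have hfactor : G ^ θ ≤ s ^ d * G := by
      nth_rewrite 2 [← Real.exp_log hG0]
      rw [Real.rpow_def_of_pos hG0, Real.rpow_def_of_pos hs, ← Real.exp_add, Real.exp_le_exp]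
      have hgap : d * -Real.log s ≤ (1 - θ) * Real.log G := by
        rcases le_or_gt 0 (Real.log s) with hlogs | hlogs
        · exact (mul_nonpos_of_nonneg_of_nonpos hd (neg_nonpos.2 hlogs)).trans
            (mul_nonneg (sub_nonneg.2 hθ1) (Real.log_nonneg hG1.le))
        · calc d * -Real.log s ≤ M * (1 - θ) * -Real.log s := by
                gcongr
                exact (neg_pos.2 hlogs).le
            _ = (1 - θ) * (M * -Real.log s) := by ring
            _ ≤ (1 - θ) * Real.log G :=
                mul_le_mul_of_nonneg_left hcase.le (sub_nonneg.2 hθ1)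
      linarith
    linarith

theorem sum_rpow_le_card_rpow_mul {ι : Type*} (s : Finset ι) (m : ι → ENNReal) {θ : ℝ}
    (hθ : 0 < θ) (hθ1 : θ ≤ 1) :
    ∑ i ∈ s, m i ^ θ ≤ (s.card : ENNReal) ^ (1 - θ) * (∑ i ∈ s, m i) ^ θ := by
  have hpow := ENNReal.rpow_le_rpow (ENNReal.rpow_sum_le_const_mul_sum_rpow s (fun i => m i ^ θ)
    ((one_le_inv₀ hθ).2 hθ1)) hθ.le
  simp_rw [ENNReal.rpow_rpow_inv hθ.ne'] at hpow
  rwa [ENNReal.rpow_inv_rpow hθ.ne', ENNReal.mul_rpow_of_nonneg _ _ hθ.le, ← ENNReal.rpow_mul,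
    sub_mul, inv_mul_cancel₀ hθ.ne', one_mul] at hpow

theorem tsum_rpow_le_of_forall_le_pow {m : ℕ → ENNReal} {ρ : ENNReal} {θ : ℝ} {K : ℕ}
    (hm : ∑' k, m k ≤ 1) (hθ : 0 < θ) (hθ1 : θ ≤ 1) (h : ∀ k, m (k + K) ≤ ρ ^ k) :
    ∑' k, m k ^ θ ≤ (K : ENNReal) ^ (1 - θ) + (1 - ρ ^ θ)⁻¹ := by
  have hhead : ∑ k ∈ Finset.range K, m k ^ θ ≤ (K : ENNReal) ^ (1 - θ) :=
    calc ∑ k ∈ Finset.range K, m k ^ θ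
        ≤ (K : ENNReal) ^ (1 - θ) * (∑ k ∈ Finset.range K, m k) ^ θ := by
          simpa using sum_rpow_le_card_rpow_mul (Finset.range K) m hθ hθ1
      _ ≤ (K : ENNReal) ^ (1 - θ) := mul_le_of_le_one_right'
          (ENNReal.rpow_le_one ((ENNReal.sum_le_tsum _).trans hm) hθ.le)
  have htail : ∑' k, m (k + K) ^ θ ≤ (1 - ρ ^ θ)⁻¹ :=
    calc ∑' k, m (k + K) ^ θ ≤ ∑' k, (ρ ^ θ) ^ k := by
          refine ENNReal.tsum_le_tsum fun k => (ENNReal.rpow_le_rpow (h k) hθ.le).trans_eq ?_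
          rw [← ENNReal.rpow_natCast_mul, ← ENNReal.rpow_mul_natCast, mul_comm]
      _ = (1 - ρ ^ θ)⁻¹ := ENNReal.tsum_geometric _
  rw [← Summable.sum_add_tsum_nat_add' (f := fun k => m k ^ θ) (k := K) ENNReal.summable]
  exact add_le_add hhead htail

theorem one_add_tsum_rpow_le_of_forall_le_pow {m : ℕ → ENNReal} {ρ θ₀ θ : ℝ} {K : ℕ}
    (hm : ∑' k, m k ≤ 1) (hρ : 0 ≤ ρ) (hρ1 : ρ < 1) (hθ₀ : 0 < θ₀) (hθ : θ₀ ≤ θ) (hθ1 : θ < 1)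
    (h : ∀ k, m (k + K) ≤ ENNReal.ofReal ρ ^ k) :
    1 + ∑' k, m k ^ θ ≤
      ENNReal.ofReal ((1 + (1 - ρ ^ θ₀)⁻¹) * (1 + (K : ℝ) ^ (1 - θ₀))) := by
  have hgap : 0 < 1 - ρ ^ θ₀ := sub_pos.2 (Real.rpow_lt_one hρ hρ1 hθ₀)
  have hhead : (K : ENNReal) ^ (1 - θ) ≤ ENNReal.ofReal ((K : ℝ) ^ (1 - θ₀)) := by
    rw [← ENNReal.ofReal_natCast, ENNReal.ofReal_rpow_of_nonneg K.cast_nonneg (by linarith)]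
    refine ENNReal.ofReal_le_ofReal ?_
    rcases K.eq_zero_or_pos with rfl | hK
    · rw [Nat.cast_zero, Real.zero_rpow (by linarith)]
      positivity
    · exact Real.rpow_le_rpow_of_exponent_le (by exact_mod_cast hK) (by linarith)
  have htail : (1 - ENNReal.ofReal ρ ^ θ)⁻¹ ≤ ENNReal.ofReal (1 - ρ ^ θ₀)⁻¹ := by
    rw [ENNReal.ofReal_inv_of_pos hgap, ENNReal.ofReal_sub _ (by positivity), ENNReal.ofReal_one,
      ← ENNReal.ofReal_rpow_of_nonneg hρ hθ₀.le]
    exact ENNReal.inv_le_inv.2 (tsub_le_tsub_left (ENNReal.rpow_le_rpow_of_exponent_ge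
      (ENNReal.ofReal_le_one.2 hρ1.le) hθ) 1)
  calc 1 + ∑' k, m k ^ θ
      ≤ 1 + (ENNReal.ofReal ((K : ℝ) ^ (1 - θ₀)) + ENNReal.ofReal (1 - ρ ^ θ₀)⁻¹) := by
        gcongr
        exact (tsum_rpow_le_of_forall_le_pow hm (hθ₀.trans_le hθ) hθ1.le h).trans
          (add_le_add hhead htail)
    _ = ENNReal.ofReal (1 + ((K : ℝ) ^ (1 - θ₀) + (1 - ρ ^ θ₀)⁻¹)) := by
        rw [← ENNReal.ofReal_add (by positivity) (by positivity), ← ENNReal.ofReal_one,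
          ← ENNReal.ofReal_add zero_le_one (by positivity)]
    _ ≤ ENNReal.ofReal ((1 + (1 - ρ ^ θ₀)⁻¹) * (1 + (K : ℝ) ^ (1 - θ₀))) := by
        refine ENNReal.ofReal_le_ofReal ?_
        rw [one_add_mul, mul_one_add]
        linarith [show 0 ≤ (1 - ρ ^ θ₀)⁻¹ * (K : ℝ) ^ (1 - θ₀) by positivity]

theorem lintegral_rpow_le {X : Type*} [MeasurableSpace X] {μ : Measure X} {g : X → ENNReal}
    (hg : AEMeasurable g μ) {θ : ℝ} (hθ : 0 ≤ θ) (hθ1 : θ ≤ 1) :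
    ∫⁻ x, g x ^ θ ∂μ ≤ (∫⁻ x, g x ∂μ) ^ θ * μ Set.univ ^ (1 - θ) := by
  simpa using ENNReal.lintegral_mul_norm_pow_le hg (aemeasurable_const (b := (1 : ENNReal))) hθ
    (sub_nonneg.2 hθ1) (add_sub_cancel θ 1)

theorem lintegral_one_add_mul_rpow_add_mul_le {X : Type*} [MeasurableSpace X] {μ : Measure X}
    {g : X → ENNReal} (hg : AEMeasurable g μ) {θ : ℝ} (hθ : 0 ≤ θ) (hθ1 : θ ≤ 1)
    (E δ : ENNReal) :
    ∫⁻ x, (1 + E * g x ^ θ + δ * g x) ∂μ ≤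
      μ Set.univ + E * ((∫⁻ x, g x ∂μ) ^ θ * μ Set.univ ^ (1 - θ)) + δ * ∫⁻ x, g x ∂μ := by
  rw [lintegral_add_right' _ (hg.const_mul δ), lintegral_add_left' aemeasurable_const,
    lintegral_const_mul'' _ (hg.pow_const θ), lintegral_const_mul'' _ hg, lintegral_one]
  gcongr
  exact lintegral_rpow_le hg hθ hθ1

theorem div_two_pow_rpow_le {R a c d : ℝ} (hR : 1 ≤ R) (hac : a ≤ c) (hcd : c ≤ d) (k : ℕ) :
    (R / 2 ^ k) ^ c ≤ R ^ d * ((2⁻¹ : ℝ) ^ a) ^ k :=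
  calc (R / 2 ^ k) ^ c = R ^ c * ((2⁻¹ : ℝ) ^ c) ^ k := by
        rw [div_eq_mul_inv, ← inv_pow, Real.mul_rpow (by positivity) (by positivity),
          ← Real.rpow_natCast_mul (by norm_num), ← Real.rpow_mul_natCast (by norm_num), mul_comm c]
    _ ≤ R ^ d * ((2⁻¹ : ℝ) ^ a) ^ k := by
        have hq : (2⁻¹ : ℝ) ^ c ≤ 2⁻¹ ^ a :=
          Real.rpow_le_rpow_of_exponent_ge (by norm_num) (by norm_num) hac
        gcongr

theorem tsum_ofReal_div_two_pow_rpow_le {R a c d : ℝ} (hR : 1 ≤ R) (ha : 0 < a) (hac : a ≤ c)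
    (hcd : c ≤ d) :
    ∑' k : ℕ, ENNReal.ofReal ((R / 2 ^ k) ^ c) ≤
      ENNReal.ofReal (R ^ d * (1 - (2⁻¹ : ℝ) ^ a)⁻¹) := by
  have hq : (2⁻¹ : ℝ) ^ a < 1 := Real.rpow_lt_one (by norm_num) (by norm_num) ha
  have hq0 : (0 : ℝ) ≤ 2⁻¹ ^ a := by positivity
  rw [← tsum_geometric_of_lt_one hq0 hq, ← tsum_mul_left, ENNReal.ofReal_tsum_of_nonneg
    (fun k => by positivity) ((summable_geometric_of_lt_one hq0 hq).mul_left _)]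
  exact ENNReal.tsum_le_tsum fun k => ENNReal.ofReal_le_ofReal (div_two_pow_rpow_le hR hac hcd k)

theorem pow_natFloor_le_inv_mul_exp {ρ : ℝ} (hρ : 0 < ρ) (hρ1 : ρ ≤ 1) (u : ℝ) :
    ρ ^ ⌊u⌋₊ ≤ ρ⁻¹ * Real.exp (Real.log ρ * u) :=
  calc ρ ^ ⌊u⌋₊ = ρ ^ (⌊u⌋₊ : ℝ) := (Real.rpow_natCast _ _).symm
    _ ≤ ρ ^ (u - 1) := Real.rpow_le_rpow_of_exponent_ge hρ hρ1 (Nat.sub_one_lt_floor u).le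
    _ = ρ⁻¹ * Real.exp (Real.log ρ * u) := by
        rw [Real.rpow_sub_one hρ.ne', Real.rpow_def_of_pos hρ, div_eq_inv_mul]

theorem exists_le_exp_of_forall_le_pow {C D M ρ P : ℝ} (hC : 0 < C) (hD : 0 < D) (hM : 0 ≤ M)
    (hρ : 0 < ρ) (hρ1 : ρ < 1) (hP : 0 < P) :
    ∃ c₁ c₂ : ℝ, 0 < c₁ ∧ 0 < c₂ ∧ ∀ Φ : ℝ → ENNReal, Antitone Φ →
      (∀ t, Φ t ≤ ENNReal.ofReal M) →
      (∀ K : ℕ, Φ (C * (1 + (K : ℝ) ^ P⁻¹)) ≤ ENNReal.ofReal (D * ρ ^ K)) →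
      ∀ t : ℝ, 0 ≤ t → Φ t ≤ ENNReal.ofReal (c₁ * Real.exp (-c₂ * t ^ P)) := by
  have hlogρ : Real.log ρ < 0 := Real.log_neg hρ hρ1
  refine ⟨(M + D) * ρ⁻¹, -Real.log ρ * ((2 * C) ^ P)⁻¹, by positivity,
    mul_pos (neg_pos.2 hlogρ) (by positivity), fun Φ hΦ hΦM hΦρ t ht => ?_⟩
  set u : ℝ := (t / (2 * C)) ^ P with hu
  have hu0 : 0 ≤ u := by positivity
  have hdiscrete : Φ t ≤ ENNReal.ofReal ((M + D) * ρ ^ ⌊u⌋₊) := by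
    rcases lt_or_ge t (2 * C) with htC | htC
    · have hfloor : ⌊u⌋₊ = 0 := Nat.floor_eq_zero.2
        (Real.rpow_lt_one (by positivity) ((div_lt_one (by positivity)).2 htC) hP)
      rw [hfloor, pow_zero, mul_one]
      exact (hΦM t).trans (ENNReal.ofReal_le_ofReal (by linarith))
    · have hlevel : C * (1 + (⌊u⌋₊ : ℝ) ^ P⁻¹) ≤ t :=
        calc C * (1 + (⌊u⌋₊ : ℝ) ^ P⁻¹) ≤ C * (1 + u ^ P⁻¹) := by
              gcongr; exact Nat.floor_le hu0
          _ = C + t / 2 := by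
              rw [hu, Real.rpow_rpow_inv (by positivity) hP.ne']
              field_simp
          _ ≤ t := by linarith
      refine (hΦ hlevel).trans ((hΦρ _).trans (ENNReal.ofReal_le_ofReal ?_))
      gcongr
      linarith
  have hexponent : Real.log ρ * u = -(-Real.log ρ * ((2 * C) ^ P)⁻¹) * t ^ P := by
    rw [hu, Real.div_rpow ht (by positivity)]
    ring
  refine hdiscrete.trans (ENNReal.ofReal_le_ofReal ?_)
  rw [mul_assoc, ← hexponent]
  gcongr
  exact pow_natFloor_le_inv_mul_exp hρ hρ1.le u

end PowerInequalities

section ModularMeasure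

variable {n : ℕ}

/-- The measure `|f|^{p(·)} dx` on `U`, which localizes the modular: its total mass is
`modular U p f`. -/
noncomputable def modularMeasure (U : Set (Space n)) (p f : Space n → ℝ) : Measure (Space n) :=
  (volume.restrict U).withDensity fun y => ENNReal.ofReal (|f y| ^ p y)

/-- The limiting exponent `n / α(·)` of the embeddings of the Riesz potential of order `α(·)`. -/
noncomputable abbrev criticalExponent (α : Space n → ℝ) : Space n → ℝ := fun x => (n : ℝ) / α x

variable {U A Ω : Set (Space n)} {p f α : Space n → ℝ}

theorem modularMeasure_univ : modularMeasure U p f Set.univ = modular U p f := by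
  simp only [modularMeasure, withDensity_apply _ MeasurableSet.univ, Measure.restrict_univ,
    modular]

theorem modularMeasure_apply (hA : MeasurableSet A) (hAU : A ⊆ U) :
    modularMeasure U p f A = ∫⁻ y in A, ENNReal.ofReal (|f y| ^ p y) := by
  rw [modularMeasure, withDensity_apply _ hA, Measure.restrict_restrict hA,
    Set.inter_eq_left.2 hAU]

theorem LogHolderOn.exists_abs_le (hlog : LogHolderOn Ω α) {b : ℝ} (hb : b < n)
    (hα : ∀ x ∈ Ω, α x ∈ Set.Ioc 0 b) :
    ∃ E : ℝ, 0 < E ∧ ∀ x ∈ Ω, ∀ y ∈ Ω, ∀ r : ℝ, 0 < r → dist x y ≤ r → ∀ c : ℝ,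
      ENNReal.ofReal |c| ≤
        1 + ENNReal.ofReal E * ENNReal.ofReal (|c| ^ criticalExponent α y) ^ (α x / n) +
          ENNReal.ofReal (r ^ n) * ENNReal.ofReal (|c| ^ criticalExponent α y) := by
  obtain ⟨L, -, hL⟩ := hlog.exists_abs_sub_mul_neg_log_le
  refine ⟨Real.exp (n * n / (n - b) * (L / n)), Real.exp_pos _,
    fun x hx y hy r hr hxyr c => ?_⟩
  obtain ⟨hαy, hαyb⟩ := hα y hy
  have hn : (0 : ℝ) < n := by linarith
  have hnb : 0 < n - b := by linarith
  have hc : (|c| ^ criticalExponent α y) ^ (α y / n) = |c| := by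
    rw [← Real.rpow_mul (abs_nonneg _), div_mul_div_cancel₀ hαy.ne', div_self hn.ne',
      Real.rpow_one]
  have hdM : (n : ℝ) ≤ n * n / (n - b) * (1 - α y / n) :=
    calc (n : ℝ) = n * n / (n - b) * (1 - b / n) := by field_simp
      _ ≤ n * n / (n - b) * (1 - α y / n) := by gcongr
  have hosc : |α y / n - α x / n| * -Real.log r ≤ L / n := by
    rw [← sub_div, abs_div, abs_of_pos hn, div_mul_eq_mul_div, abs_sub_comm]
    gcongr
    exact hL x hx y hy r hr hxyr
  have h := rpow_le_one_add_exp_mul_rpow_add (G := |c| ^ criticalExponent α y) (by positivity) hr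
    (by positivity) (by positivity) ((div_le_one hn).2 (by linarith)) hn.le hdM hosc
  rw [hc, Real.rpow_natCast] at h
  rw [ENNReal.ofReal_rpow_of_nonneg (by positivity) (div_nonneg (hα x hx).1.le hn.le),
    ← ENNReal.ofReal_mul (Real.exp_nonneg _), ← ENNReal.ofReal_mul (by positivity),
    ← ENNReal.ofReal_one, ← ENNReal.ofReal_add zero_le_one (by positivity),
    ← ENNReal.ofReal_add (by positivity) (by positivity)]
  exact ENNReal.ofReal_le_ofReal h

theorem volume_closedBall_eq (x : Space n) {r : ℝ} (hr : 0 ≤ r) :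
    volume (Metric.closedBall x r) =
      ENNReal.ofReal (volume.real (Metric.closedBall (0 : Space n) 1) * r ^ n) := by
  rw [Measure.addHaar_closedBall' _ _ hr, finrank_euclideanSpace_fin, mul_comm,
    ENNReal.ofReal_mul measureReal_nonneg, ofReal_measureReal measure_closedBall_lt_top.ne]

theorem volume_rpow_le {x : Space n} {r s : ℝ} (hr : 0 < r) (hA : A ⊆ Metric.closedBall x r)
    (hs : 0 ≤ s) (hsn : s < n) :
    volume A ^ (1 - s / n) ≤ ENNReal.ofReal
      ((1 + volume.real (Metric.closedBall (0 : Space n) 1)) * r ^ (n - s)) := by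
  set V : ℝ := volume.real (Metric.closedBall (0 : Space n) 1)
  have hV : 0 ≤ V := measureReal_nonneg
  have hn : (0 : ℝ) < n := hs.trans_lt hsn
  have hθ : 0 ≤ 1 - s / n := sub_nonneg.2 ((div_le_one hn).2 hsn.le)
  have hVpow : V ^ (1 - s / n) ≤ 1 + V :=
    calc V ^ (1 - s / n) ≤ (1 + V) ^ (1 - s / n) := by gcongr; linarith
      _ ≤ 1 + V := Real.rpow_le_self_of_one_le (by linarith) (sub_le_self _ (by positivity))
  have hrpow : (r ^ n) ^ (1 - s / n) = r ^ (n - s) := by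
    rw [← Real.rpow_natCast_mul hr.le, mul_sub, mul_one, mul_div_cancel₀ _ hn.ne']
  calc volume A ^ (1 - s / n) ≤ ENNReal.ofReal (V * r ^ n) ^ (1 - s / n) :=
        ENNReal.rpow_le_rpow ((measure_mono hA).trans_eq (volume_closedBall_eq x hr.le)) hθ
    _ = ENNReal.ofReal (V ^ (1 - s / n) * r ^ (n - s)) := by
        rw [ENNReal.ofReal_rpow_of_nonneg (by positivity) hθ,
          Real.mul_rpow hV (by positivity), hrpow]
    _ ≤ ENNReal.ofReal ((1 + V) * r ^ (n - s)) := by gcongr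

end ModularMeasure

section Annulus

/-- The part of `U` at distance between `r / 2` and `r` from `x`; the radii `r = R / 2 ^ k` give
the dyadic decomposition of `U \ {x}`. -/
def annulus {X : Type*} [Dist X] (U : Set X) (x : X) (r : ℝ) : Set X :=
  {y ∈ U | r / 2 < dist x y ∧ dist x y ≤ r}

variable {X : Type*} [MetricSpace X] {U : Set X} {x : X} {r R : ℝ}

theorem annulus_subset : annulus U x r ⊆ U := fun _ hy => hy.1

theorem annulus_subset_closedBall : annulus U x r ⊆ Metric.closedBall x r :=
  fun _ hy => Metric.mem_closedBall'.2 hy.2.2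

theorem measurableSet_annulus [MeasurableSpace X] [OpensMeasurableSpace X]
    (hU : MeasurableSet U) : MeasurableSet (annulus U x r) :=
  have hd : Measurable fun y => dist x y := (continuous_const.dist continuous_id).measurable
  hU.inter ((measurableSet_lt measurable_const hd).inter (measurableSet_le hd measurable_const))

theorem pairwise_disjoint_annulus_dyadic (hR : 0 ≤ R) :
    Pairwise (Function.onFun Disjoint fun k : ℕ => annulus U x (R / 2 ^ k)) := by
  refine pairwise_disjoint_on _ |>.2 fun i j hij => Set.disjoint_left.2 fun y hi hj => ?_
  have hle : R / 2 ^ j ≤ R / 2 ^ (i + 1) := by gcongr; exacts [one_le_two, hij]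
  rw [pow_succ, ← div_div] at hle
  exact (hi.2.1.trans_le (hj.2.2.trans hle)).false

theorem subset_iUnion_annulus_dyadic_union (hR : 0 < R) (h : ∀ y ∈ U, dist x y ≤ R) :
    U ⊆ (⋃ k : ℕ, annulus U x (R / 2 ^ k)) ∪ {x} := by
  intro y hy
  rcases eq_or_ne x y with rfl | hne
  · exact Or.inr rfl
  obtain ⟨k, hk, hk'⟩ := exists_nat_pow_near_of_lt_one (x := dist x y / R) (y := (2⁻¹ : ℝ))
    (div_pos (dist_pos.2 hne) hR) ((div_le_one hR).2 (h y hy)) (by norm_num) (by norm_num)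
  rw [lt_div_iff₀' hR, inv_pow, ← div_eq_mul_inv, pow_succ, ← div_div] at hk
  rw [div_le_iff₀' hR, inv_pow, ← div_eq_mul_inv] at hk'
  exact Or.inl (Set.mem_iUnion.2 ⟨k, hy, hk, hk'⟩)

theorem setLIntegral_annulus_div_dist_rpow_le [MeasurableSpace X] [OpensMeasurableSpace X]
    (μ : Measure X) (hU : MeasurableSet U) (hr : 0 < r) {d : ℝ} (hd : 0 ≤ d) (f : X → ℝ) :
    ∫⁻ y in annulus U x r, ENNReal.ofReal (|f y| / dist x y ^ d) ∂μ ≤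
      ENNReal.ofReal ((2 / r) ^ d) * ∫⁻ y in annulus U x r, ENNReal.ofReal |f y| ∂μ := by
  rw [← lintegral_const_mul' _ _ ENNReal.ofReal_ne_top]
  refine setLIntegral_mono' (measurableSet_annulus hU) fun y hy => ?_
  rw [← ENNReal.ofReal_mul (by positivity)]
  refine ENNReal.ofReal_le_ofReal ?_
  calc |f y| / dist x y ^ d ≤ |f y| / (r / 2) ^ d := by gcongr; exact hy.2.1.le
    _ = (2 / r) ^ d * |f y| := by
        rw [← inv_div r 2, Real.inv_rpow (by positivity), inv_mul_eq_div]

end Annulus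

section RieszPotential

variable {n : ℕ} {Ω A : Set (Space n)} {α f : Space n → ℝ}

theorem LogHolderOn.aemeasurable_abs_rpow_criticalExponent (hΩ : MeasurableSet Ω)
    (hlog : LogHolderOn Ω α) (hf : AEStronglyMeasurable f (volume.restrict Ω)) :
    AEMeasurable (fun y => ENNReal.ofReal (|f y| ^ criticalExponent α y)) (volume.restrict Ω) :=
  ((continuous_abs.measurable.comp_aemeasurable hf.aemeasurable).pow
    ((hlog.continuousOn.aemeasurable hΩ).const_div _)).ennreal_ofReal

theorem LogHolderOn.exists_setLIntegral_abs_le (hΩ : MeasurableSet Ω) (hlog : LogHolderOn Ω α)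
    {b : ℝ} (hb : b < n) (hα : ∀ x ∈ Ω, α x ∈ Set.Ioc 0 b) :
    ∃ C : ℝ, 0 < C ∧ ∀ f : Space n → ℝ, AEStronglyMeasurable f (volume.restrict Ω) →
      modular Ω (criticalExponent α) f ≤ 1 → ∀ x ∈ Ω, ∀ r : ℝ, 0 < r → ∀ A : Set (Space n),
        MeasurableSet A → A ⊆ Ω → A ⊆ Metric.closedBall x r →
          ∫⁻ y in A, ENNReal.ofReal |f y| ≤ ENNReal.ofReal (C * r ^ n) +
            ENNReal.ofReal (C * r ^ (n - α x)) *
              modularMeasure Ω (criticalExponent α) f A ^ (α x / n) := by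
  obtain ⟨E, hE, hpointwise⟩ := hlog.exists_abs_le hb hα
  set V : ℝ := volume.real (Metric.closedBall (0 : Space n) 1)
  refine ⟨(1 + V) * (1 + E), by positivity, fun f hf hmod x hx r hr A hA hAΩ hAr => ?_⟩
  have hαn : α x < n := (hα x hx).2.trans_lt hb
  have hn : (0 : ℝ) < n := (hα x hx).1.trans hαn
  have hθ : 0 ≤ α x / n := div_nonneg (hα x hx).1.le hn.le
  set g : Space n → ENNReal := fun y => ENNReal.ofReal (|f y| ^ criticalExponent α y)
  set m : ENNReal := modularMeasure Ω (criticalExponent α) f A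
  have hmg : ∫⁻ y in A, g y = m := (modularMeasure_apply hA hAΩ).symm
  have hm : m ≤ 1 := (measure_mono (Set.subset_univ A)).trans (modularMeasure_univ.trans_le hmod)
  have hvol : volume A ≤ ENNReal.ofReal (V * r ^ n) :=
    (measure_mono hAr).trans_eq (volume_closedBall_eq x hr.le)
  have hgm : AEMeasurable g (volume.restrict A) :=
    (hlog.aemeasurable_abs_rpow_criticalExponent hΩ hf).mono_measure
      (Measure.restrict_mono_set _ hAΩ)
  calc ∫⁻ y in A, ENNReal.ofReal |f y|
      ≤ volume A + ENNReal.ofReal E * (m ^ (α x / n) * volume A ^ (1 - α x / n)) +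
          ENNReal.ofReal (r ^ n) * m := by
        simpa only [hmg, Measure.restrict_apply_univ] using
          (setLIntegral_mono' hA fun y hy => hpointwise x hx y (hAΩ hy) r hr
            (Metric.mem_closedBall'.1 (hAr hy)) (f y)).trans 
            (lintegral_one_add_mul_rpow_add_mul_le hgm hθ ((div_le_one hn).2 hαn.le)
              (ENNReal.ofReal E) (ENNReal.ofReal (r ^ n)))
    _ ≤ ENNReal.ofReal (V * r ^ n) + ENNReal.ofReal E * (m ^ (α x / n) *
          ENNReal.ofReal ((1 + V) * r ^ (n - α x))) + ENNReal.ofReal (r ^ n) * 1 := by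
        gcongr
        exact volume_rpow_le hr hAr (hα x hx).1.le hαn
    _ = ENNReal.ofReal ((1 + V) * r ^ n) +
          ENNReal.ofReal ((1 + V) * E * r ^ (n - α x)) * m ^ (α x / n) := by
        rw [add_comm 1 V, add_one_mul V (r ^ n), ENNReal.ofReal_add (by positivity) (by positivity),
          mul_comm (V + 1) E, mul_assoc E, ENNReal.ofReal_mul hE.le]
        ring
    _ ≤ ENNReal.ofReal ((1 + V) * (1 + E) * r ^ n) +
          ENNReal.ofReal ((1 + V) * (1 + E) * r ^ (n - α x)) * m ^ (α x / n) := by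
        gcongr
        · exact le_mul_of_one_le_right (by positivity) (by linarith)
        · linarith

theorem rieszPotential_le_tsum {x : Space n} {R : ℝ} (hR : 0 < R)
    (h : ∀ y ∈ Ω, dist x y ≤ R) (hα : α x ≠ n) :
    rieszPotential Ω α f x ≤ ∑' k : ℕ,
      ∫⁻ y in annulus Ω x (R / 2 ^ k), ENNReal.ofReal (|f y| / dist x y ^ ((n : ℝ) - α x)) := by
  have hcentre : ∫⁻ y in {x}, ENNReal.ofReal (|f y| / dist x y ^ ((n : ℝ) - α x)) = 0 := by
    simp [Real.zero_rpow (sub_ne_zero.2 hα.symm)]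
  refine (lintegral_mono_set (subset_iUnion_annulus_dyadic_union hR h)).trans
    ((lintegral_union_le _ _ _).trans ?_)
  rw [hcentre, add_zero]
  exact lintegral_iUnion_le _ _

theorem LogHolderOn.exists_setLIntegral_annulus_le (hΩ : MeasurableSet Ω)
    (hlog : LogHolderOn Ω α) {b : ℝ} (hb : b < n) (hα : ∀ x ∈ Ω, α x ∈ Set.Ioc 0 b) :
    ∃ C : ℝ, 0 < C ∧ ∀ f : Space n → ℝ, AEStronglyMeasurable f (volume.restrict Ω) →
      modular Ω (criticalExponent α) f ≤ 1 → ∀ x ∈ Ω, ∀ r : ℝ, 0 < r →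
        ∫⁻ y in annulus Ω x r, ENNReal.ofReal (|f y| / dist x y ^ ((n : ℝ) - α x)) ≤
          ENNReal.ofReal C * (ENNReal.ofReal (r ^ α x) +
            modularMeasure Ω (criticalExponent α) f (annulus Ω x r) ^ (α x / n)) := by
  obtain ⟨C, hC, hbound⟩ := hlog.exists_setLIntegral_abs_le hΩ hb hα
  refine ⟨2 ^ (n : ℝ) * C, by positivity, fun f hf hmod x hx r hr => ?_⟩
  obtain ⟨hαx, hαxb⟩ := hα x hx
  have hd : (0 : ℝ) ≤ n - α x := by linarith
  set m : ENNReal := modularMeasure Ω (criticalExponent α) f (annulus Ω x r)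
  have hscale : (2 / r) ^ (n - α x) * r ^ (n - α x) ≤ 2 ^ (n : ℝ) := by
    rw [← Real.mul_rpow (by positivity) hr.le, div_mul_cancel₀ _ hr.ne']
    exact Real.rpow_le_rpow_of_exponent_le one_le_two (by linarith)
  have hscale' : (2 / r) ^ (n - α x) * r ^ n ≤ 2 ^ (n : ℝ) * r ^ α x := by
    rw [← Real.rpow_natCast r, ← sub_add_cancel (n : ℝ) (α x), Real.rpow_add hr, ← mul_assoc,
      sub_add_cancel]
    gcongr
  calc ∫⁻ y in annulus Ω x r, ENNReal.ofReal (|f y| / dist x y ^ ((n : ℝ) - α x))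
      ≤ ENNReal.ofReal ((2 / r) ^ (n - α x)) * (ENNReal.ofReal (C * r ^ n) +
          ENNReal.ofReal (C * r ^ (n - α x)) * m ^ (α x / n)) :=
        (setLIntegral_annulus_div_dist_rpow_le volume hΩ hr hd f).trans
          (mul_le_mul_right (hbound f hf hmod x hx r hr _ (measurableSet_annulus hΩ)
            annulus_subset annulus_subset_closedBall) _)
    _ = ENNReal.ofReal (C * ((2 / r) ^ (n - α x) * r ^ n)) +
          ENNReal.ofReal (C * ((2 / r) ^ (n - α x) * r ^ (n - α x))) * m ^ (α x / n) := by
        rw [mul_add, ← mul_assoc, ← ENNReal.ofReal_mul (by positivity),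
          ← ENNReal.ofReal_mul (by positivity), mul_left_comm C, mul_left_comm C]
    _ ≤ ENNReal.ofReal (C * (2 ^ (n : ℝ) * r ^ α x)) +
          ENNReal.ofReal (C * 2 ^ (n : ℝ)) * m ^ (α x / n) := by gcongr
    _ = ENNReal.ofReal (2 ^ (n : ℝ) * C) * (ENNReal.ofReal (r ^ α x) + m ^ (α x / n)) := by
        rw [mul_add, ← ENNReal.ofReal_mul (by positivity), mul_comm C, mul_comm C, mul_right_comm]

theorem LogHolderOn.exists_rieszPotential_le_tsum (hΩ : MeasurableSet Ω) (hlog : LogHolderOn Ω α)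
    {a b R : ℝ} (ha : 0 < a) (hb : b < n) (hα : ∀ x ∈ Ω, α x ∈ Set.Icc a b) (hR : 1 ≤ R)
    (hΩR : ∀ x ∈ Ω, ∀ y ∈ Ω, dist x y ≤ R) :
    ∃ C : ℝ, 0 < C ∧ ∀ f : Space n → ℝ, AEStronglyMeasurable f (volume.restrict Ω) →
      modular Ω (criticalExponent α) f ≤ 1 → ∀ x ∈ Ω,
        rieszPotential Ω α f x ≤ ENNReal.ofReal C * (1 + ∑' k : ℕ,
          modularMeasure Ω (criticalExponent α) f (annulus Ω x (R / 2 ^ k)) ^ (α x / n)) := by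
  obtain ⟨C, hC, hbound⟩ := hlog.exists_setLIntegral_annulus_le hΩ hb
    fun x hx => ⟨ha.trans_le (hα x hx).1, (hα x hx).2⟩
  have hq : (2⁻¹ : ℝ) ^ a < 1 := Real.rpow_lt_one (by norm_num) (by norm_num) ha
  set S : ℝ := R ^ (n : ℝ) * (1 - 2⁻¹ ^ a)⁻¹
  have hS : 0 ≤ S := mul_nonneg (by positivity) (inv_nonneg.2 (sub_nonneg.2 hq.le))
  refine ⟨C * (1 + S), by positivity, fun f hf hmod x hx => ?_⟩
  obtain ⟨hαa, hαb⟩ := hα x hx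
  set T : ENNReal := ∑' k : ℕ,
    modularMeasure Ω (criticalExponent α) f (annulus Ω x (R / 2 ^ k)) ^ (α x / n)
  calc rieszPotential Ω α f x
      ≤ ∑' k : ℕ, ENNReal.ofReal C * (ENNReal.ofReal ((R / 2 ^ k) ^ α x) +
          modularMeasure Ω (criticalExponent α) f (annulus Ω x (R / 2 ^ k)) ^ (α x / n)) :=
        (rieszPotential_le_tsum (by linarith) (hΩR x hx) (by linarith)).trans
          (ENNReal.tsum_le_tsum fun k => hbound f hf hmod x hx _ (by positivity))
    _ ≤ ENNReal.ofReal C * (ENNReal.ofReal S + T) := by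
        rw [ENNReal.tsum_mul_left, ENNReal.tsum_add]
        gcongr
        exact tsum_ofReal_div_two_pow_rpow_le hR ha hαa (hαb.trans hb.le)
    _ ≤ ENNReal.ofReal C * (ENNReal.ofReal (1 + S) * (1 + T)) := by
        rw [mul_add (ENNReal.ofReal (1 + S)), mul_one]
        gcongr
        · linarith
        · exact le_mul_of_one_le_left' (ENNReal.one_le_ofReal.2 (by linarith))
    _ = ENNReal.ofReal (C * (1 + S)) * (1 + T) := by rw [ENNReal.ofReal_mul hC.le, mul_assoc]

end RieszPotential

section Content

variable {n : ℕ} {Ω : Set (Space n)} {α : Space n → ℝ}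

theorem tsum_modularMeasure_annulus_le_one {p f : Space n → ℝ} (hΩ : MeasurableSet Ω)
    (hmod : modular Ω p f ≤ 1) {R : ℝ} (hR : 0 ≤ R) (x : Space n) :
    ∑' k : ℕ, modularMeasure Ω p f (annulus Ω x (R / 2 ^ k)) ≤ 1 :=
  (tsum_meas_le_meas_iUnion_of_disjoint _ (fun _ => measurableSet_annulus hΩ)
    (pairwise_disjoint_annulus_dyadic hR)).trans
    ((measure_mono (Set.subset_univ _)).trans (modularMeasure_univ.trans_le hmod))

theorem LogHolderOn.exists_closedBall_of_lt_rieszPotential (hΩ : MeasurableSet Ω)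
    (hlog : LogHolderOn Ω α) {a b R : ℝ} (ha : 0 < a) (hb : b < n)
    (hα : ∀ x ∈ Ω, α x ∈ Set.Icc a b) (hR : 1 ≤ R) (hΩR : ∀ x ∈ Ω, ∀ y ∈ Ω, dist x y ≤ R) :
    ∃ C : ℝ, 0 < C ∧ ∀ f : Space n → ℝ, AEStronglyMeasurable f (volume.restrict Ω) →
      modular Ω (criticalExponent α) f ≤ 1 → ∀ (K : ℕ), ∀ x ∈ Ω,
        ENNReal.ofReal (C * (1 + (K : ℝ) ^ (1 - a / n))) < rieszPotential Ω α f x →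
          ∃ r : ℝ, 0 < r ∧ r ≤ R ∧ ENNReal.ofReal (r ^ (n - α x)) ≤
            ENNReal.ofReal (R ^ (n : ℝ) * ((2⁻¹ : ℝ) ^ (n - b)) ^ K) *
              modularMeasure Ω (criticalExponent α) f (Metric.closedBall x r) := by
  obtain ⟨C, hC, hpotential⟩ := hlog.exists_rieszPotential_le_tsum hΩ ha hb hα hR hΩR
  set ρ : ℝ := (2⁻¹ : ℝ) ^ (n - b)
  have hρ : 0 ≤ ρ := by positivity
  have hρ1 : ρ < 1 := Real.rpow_lt_one (by norm_num) (by norm_num) (sub_pos.2 hb)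
  have hgap : 0 ≤ 1 - ρ ^ (a / n) := sub_nonneg.2 (Real.rpow_le_one hρ hρ1.le (by positivity))
  refine ⟨C * (1 + (1 - ρ ^ (a / n))⁻¹), by positivity, fun f hf hmod K x hx hlt => ?_⟩
  obtain ⟨hαa, hαb⟩ := hα x hx
  have hn : (0 : ℝ) < n := by linarith
  set μ := modularMeasure Ω (criticalExponent α) f
  by_contra! hsmall
  refine hlt.not_ge ?_
  have hdecay : ∀ k, μ (annulus Ω x (R / 2 ^ (k + K))) ≤ ENNReal.ofReal ρ ^ k := by
    intro k
    have hscale : (R / 2 ^ (k + K)) ^ (n - α x) ≤ R ^ (n : ℝ) * ρ ^ K * ρ ^ k := by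
      rw [mul_assoc, ← pow_add, add_comm K]
      exact div_two_pow_rpow_le hR (by linarith) (by linarith) _
    have hball := (hsmall (R / 2 ^ (k + K)) (by positivity)
      (div_le_self (by linarith) (one_le_pow₀ one_le_two))).trans_le
      (ENNReal.ofReal_le_ofReal hscale)
    rw [ENNReal.ofReal_mul (q := ρ ^ k) (by positivity), ENNReal.ofReal_pow hρ k] at hball
    exact (measure_mono annulus_subset_closedBall).trans (lt_of_mul_lt_mul_left' hball).le
  calc rieszPotential Ω α f x
      ≤ ENNReal.ofReal C * (1 + ∑' k : ℕ, μ (annulus Ω x (R / 2 ^ k)) ^ (α x / n)) :=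
        hpotential f hf hmod x hx
    _ ≤ ENNReal.ofReal (C * (1 + (1 - ρ ^ (a / n))⁻¹) * (1 + (K : ℝ) ^ (1 - a / n))) := by
        rw [mul_assoc, ENNReal.ofReal_mul hC.le]
        gcongr
        exact one_add_tsum_rpow_le_of_forall_le_pow
          (tsum_modularMeasure_annulus_le_one hΩ hmod (by linarith) x) hρ hρ1 (by positivity)
          (by gcongr) ((div_lt_one hn).2 (by linarith)) hdecay

theorem LogHolderOn.exists_hausdorffContent_le_pow (hΩ : MeasurableSet Ω) (hne : Ω.Nonempty)
    (hlog : LogHolderOn Ω α) {a b R : ℝ} (ha : 0 < a) (hb : b < n)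
    (hα : ∀ x ∈ Ω, α x ∈ Set.Icc a b) (hR : 1 ≤ R) (hΩR : ∀ x ∈ Ω, ∀ y ∈ Ω, dist x y ≤ R) :
    ∃ C D : ℝ, 0 < C ∧ 0 < D ∧ ∀ f : Space n → ℝ, AEStronglyMeasurable f (volume.restrict Ω) →
      modular Ω (criticalExponent α) f ≤ 1 → ∀ K : ℕ,
        hausdorffContent Ω (fun x => (n : ℝ) - α x) {x | x ∈ Ω ∧
            ENNReal.ofReal (C * (1 + (K : ℝ) ^ (1 - a / n))) < rieszPotential Ω α f x} ≤
          ENNReal.ofReal (D * ((2⁻¹ : ℝ) ^ (n - b)) ^ K) := by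
  obtain ⟨C, hC, hball⟩ := hlog.exists_closedBall_of_lt_rieszPotential hΩ ha hb hα hR hΩR
  refine ⟨C, 6 ^ n * R ^ (n : ℝ), hC, by positivity, fun f hf hmod K => ?_⟩
  set ρ : ℝ := (2⁻¹ : ℝ) ^ (n - b)
  have hdim : ∀ x ∈ Ω, (n : ℝ) - α x ∈ Set.Ioc 0 (n : ℝ) := fun x hx =>
    ⟨by linarith [(hα x hx).2], by linarith [(hα x hx).1]⟩
  calc _ ≤ 6 ^ n * (ENNReal.ofReal (R ^ (n : ℝ) * ρ ^ K) *
          modularMeasure Ω (criticalExponent α) f Set.univ) :=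
        hausdorffContent_le_of_forall_closedBall hne hdim (fun x hx => hx.1) _
          fun x hx => hball f hf hmod K x hx.1 hx.2
    _ ≤ 6 ^ n * (ENNReal.ofReal (R ^ (n : ℝ) * ρ ^ K) * 1) := by
        rw [modularMeasure_univ]
        gcongr
    _ = ENNReal.ofReal (6 ^ n * R ^ (n : ℝ) * ρ ^ K) := by
        rw [mul_one, mul_assoc, ENNReal.ofReal_mul (p := 6 ^ n) (by positivity),
          ENNReal.ofReal_pow (by norm_num), ENNReal.ofReal_ofNat]

end Content

end VarRiesz

open VarRiesz in
theorem theorem1p1_general {n : ℕ} {Ω : Set (Space n)} (hΩ : MeasurableSet Ω)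
    (hne : Ω.Nonempty) (hbdd : Bornology.IsBounded Ω) {α : Space n → ℝ} (hlog : LogHolderOn Ω α)
    {a b : ℝ} (ha : 0 < a) (hb : b < n) (hα : ∀ x ∈ Ω, α x ∈ Set.Icc a b) :
    ∃ c₁ c₂ : ℝ, 0 < c₁ ∧ 0 < c₂ ∧ ∀ f : Space n → ℝ,
      MemVarLp Ω (fun x => (n : ℝ) / α x) f → luxemburgNorm Ω (fun x => (n : ℝ) / α x) f ≤ 1 →
      ∀ t : ℝ, 0 ≤ t →
        hausdorffContent Ω (fun x => (n : ℝ) - α x)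
            {x | x ∈ Ω ∧ ENNReal.ofReal t < rieszPotential Ω α f x} ≤
          ENNReal.ofReal (c₁ * Real.exp (-c₂ * t ^ ((n : ℝ) / (n - a)))) := by
  obtain ⟨x₀, hx₀⟩ := hne
  have han : a < n := ((hα x₀ hx₀).1.trans (hα x₀ hx₀).2).trans_lt hb
  have hn : (0 : ℝ) < n := ha.trans han
  obtain ⟨R, hR, hΩR⟩ := Metric.isBounded_iff_exists_ge 1 |>.1 hbdd
  obtain ⟨C, D, hC, hD, hdecay⟩ := hlog.exists_hausdorffContent_le_pow hΩ ⟨x₀, hx₀⟩ ha hb hα hR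
    fun x hx y hy => hΩR hx hy
  have hP : ((n : ℝ) / (n - a))⁻¹ = 1 - a / n := by rw [inv_div, sub_div, div_self hn.ne']
  rw [← hP] at hdecay
  obtain ⟨c₁, c₂, hc₁, hc₂, hexp⟩ := exists_le_exp_of_forall_le_pow hC hD
    (M := (R + 1) ^ ((n : ℝ) - α x₀)) (by positivity) (ρ := (2⁻¹ : ℝ) ^ (n - b)) (by positivity)
    (Real.rpow_lt_one (by norm_num) (by norm_num) (sub_pos.2 hb))
    (div_pos hn (sub_pos.2 han))
  refine ⟨c₁, c₂, hc₁, hc₂, fun f hf hnorm => hexp _ ?_ (fun t => ?_) (hdecay f hf.1 ?_)⟩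
  · exact fun s t hst => hausdorffContent_mono fun x hx =>
      ⟨hx.1, (ENNReal.ofReal_le_ofReal hst).trans_lt hx.2⟩
  · exact hausdorffContent_le_of_subset_ball
      (fun x hx => sub_pos.2 ((hα x hx).2.trans_lt hb)) hx₀ (by positivity)
      fun x hx => (hΩR hx.1 hx₀).trans_lt (lt_add_one R)
  · exact modular_le_one_of_luxemburgNorm_le_one hΩ (q := n / a) (fun x hx =>
      ⟨(one_le_div (ha.trans_le (hα x hx).1)).2 ((hα x hx).2.trans hb.le),
        div_le_div_of_nonneg_left hn.le ha (hα x hx).1⟩) hf.2 hnorm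

theorem theorem1p1 (n : ℕ) (hn : 2 ≤ n) (Ω : Set (VarRiesz.Space n)) (hopen : IsOpen Ω)
    (hbdd : Bornology.IsBounded Ω) (α : VarRiesz.Space n → ℝ)
    (hrange : ∀ x ∈ Ω, 0 ≤ α x ∧ α x < n)
    (hlog : VarRiesz.LogHolderOn Ω α)
    (hinf : 0 < VarRiesz.essInfOn Ω α)
    (hsup : VarRiesz.essSupOn Ω α < n) :
    ∃ c₁ c₂ : ℝ, 0 < c₁ ∧ 0 < c₂ ∧
      ∀ f : VarRiesz.Space n → ℝ,
        VarRiesz.MemVarLp Ω (fun x => (n : ℝ) / α x) f →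
        VarRiesz.luxemburgNorm Ω (fun x => (n : ℝ) / α x) f
          ≤ 1 / (2 * (1 + (MeasureTheory.volume Ω).toReal)) →
        ∀ t : ℝ, 0 ≤ t →
          VarRiesz.hausdorffContent Ω (fun x => (n : ℝ) - α x)
              {x | x ∈ Ω ∧ ENNReal.ofReal t < VarRiesz.rieszPotential Ω α f x}
            ≤ ENNReal.ofReal
                (c₁ * Real.exp (-c₂ * t ^ ((n : ℝ) / ((n : ℝ) - VarRiesz.essInfOn Ω α)))) := by
  have hα : ∀ x ∈ Ω, α x ∈ Set.Icc (VarRiesz.essInfOn Ω α) (VarRiesz.essSupOn Ω α) := fun x hx =>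
    ⟨VarRiesz.essInfOn_le hopen hlog.continuousOn (fun y hy => (hrange y hy).1) x hx,
      VarRiesz.le_essSupOn hopen hlog.continuousOn (fun y hy => (hrange y hy).2.le) x hx⟩
  obtain ⟨c₁, c₂, hc₁, hc₂, h⟩ := theorem1p1_general hopen.measurableSet
    (VarRiesz.nonempty_of_essInfOn_pos hinf) hbdd hlog hinf hsup hα
  refine ⟨c₁, c₂, hc₁, hc₂, fun f hf hnorm => h f hf (hnorm.trans ?_)⟩
  rw [div_le_one (by positivity)]
  linarith [ENNReal.toReal_nonneg (a := volume Ω)]
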